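/- **Setting.** Let $D$ be a tensor order and $d_1,\dots,d_D$ dimensions. For tensors $\boldsymbol X,\boldsymbol B\in\mathbb R^{d_1\times\cdots\times d_D}$ let $\boldsymbol X\circ\boldsymbol B=\sum_{j}\boldsymbol X[j]\,\boldsymbol B[j]$, the sum over all multi-indices $j$. Fix a complete binary tree of depth $K<\infty$ (all leaves at depth $K$) whose internal nodes carry fixed split rules "$\boldsymbol X[j]\le c$" (left) / "$\boldsymbol X[j]>c$" (right), and let $R_t\subseteq\mathbb R^{d_1\times\cdots\times d_D}$ be the cell of the leaf $t$. Let $(\boldsymbol X_i,E_i)_{i\ge 1}$ be independent pairs of a random input tensor and a real random error. Let $t$ be a leaf such that * (i.i.d. leaf sample, normal errors) for a probability measure $Q_t$ and a variance $\sigma_t^2>0$ that do not depend on $i$, the conditional law of $(\boldsymbol X_i,E_i)$ given $\boldsymbol X_i\in R_t$ is $Q_t\otimes N(0,\sigma_t^2)$ for every $i$ with $\mathbb P(\boldsymbol X_i\in R_t)>0$; * the number $n_t=\#\{i\le n:\boldsymbol X_i\in R_t\}$ of observations in the leaf tends to infinity almost surely as $n\to\infty$. The responses satisfy $y_i=\boldsymbol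 X_i\circ\boldsymbol B_0(t)+E_i$ whenever $\boldsymbol X_i\in R_t$. For a parametrisation $\theta\mapsto\boldsymbol B(\theta)$ of the coefficient and a parameter space $\Theta_t$, a maximum likelihood estimate $\hat\theta_n(t)$ is a maximiser over $\theta\in\Theta_t$ of the Gaussian likelihood $\prod_{i\le n,\ \boldsymbol X_i\in R_t}\varphi_{\sigma_t^2}(y_i-\boldsymbol X_i\circ\boldsymbol B(\theta))$, where $\varphi_{s}$ is the density of $N(0,s)$, and $\hat{\boldsymbol B}_n(t)=\boldsymbol B(\hat\theta_n(t))$. Let $P_\theta$ be the law of $(\boldsymbol X,\boldsymbol X\circ\boldsymbol B(\theta)+E)$ for $(\boldsymbol X,E)\sim Q_t\otimes N(0,\sigma_t^2)$. **Proposition.** (a) (CP) Let $\theta=(\lambda_r,\mathbf a^{(m)}_r)_{r\le R,\,m\le D}$ with $\lambda_r\in\mathbb R$, $\mathbf a_r^{(m)}\in\mathbb R^{d_m}$, and $\boldsymbol B(\theta)=\sum_{r=1}^R\lambda_r\,\mathbf a^{(1)}_r\times\cdots\times\mathbf a^{(D)}_r$. Let $\Theta_t$ be a compact set of such parameters, $\theta_0\in\Theta_t$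 and $\boldsymbol B_0(t)=\boldsymbol B(\theta_0)$. Suppose that $\theta_0$ is globally identifiable in $\Theta_t$ up to permutation: if $\theta\in\Theta_t$ and $P_\theta=P_{\theta_0}$, then the rank-one components $\lambda_r\mathbf a^{(1)}_r\times\cdots\times\mathbf a^{(D)}_r$, $r=1,\dots,R$, of $\theta$ are those of $\theta_0$ up to a permutation of $\{1,\dots,R\}$. Then a maximum likelihood estimate exists for every $n$, and for every choice of maximum likelihood estimates $\hat{\boldsymbol B}_n(t)\to\boldsymbol B_0(t)$ in probability as $n\to\infty$. (b) (Tucker) Let $\theta=(\mathbf G,\mathbf A_1,\dots,\mathbf A_D)$ with $\mathbf G\in\mathbb R^{R_1\times\cdots\times R_D}$, $\mathbf A_m\in\mathbb R^{R_m\times d_m}$, and $\boldsymbol B(\theta)=\mathbf G\times_1\mathbf A_1\times_2\cdots\times_D\mathbf A_D$, i.e. the sum over $\rho=(\rho_1,\dots,\rho_D)$ of the components $\mathbf G[\rho]\,\mathbf A_1[\rho_1,:]\times\cdots\times\mathbf A_D[\rho_D,:]$. Let $\Theta_t$ be a compact set of such parameters, $\theta_0\in\Theta_t$ and $\boldsymbol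 B_0(t)=\boldsymbol B(\theta_0)$. Suppose that $\theta_0$ is globally identifiable in $\Theta_t$ up to permutation: if $\theta\in\Theta_t$ and $P_\theta=P_{\theta_0}$, then there are permutations $\sigma_m$ of $\{1,\dots,R_m\}$, $m=1,\dots,D$, such that for every $\rho$ the component of $\theta$ at $(\sigma_1(\rho_1),\dots,\sigma_D(\rho_D))$ equals the component of $\theta_0$ at $\rho$. Then a maximum likelihood estimate exists for every $n$, and for every choice of maximum likelihood estimates $\hat{\boldsymbol B}_n(t)\to\boldsymbol B_0(t)$ in probability as $n\to\infty$. -/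

import Mathlib

open MeasureTheory ProbabilityTheory Filter
open scoped NNReal ENNReal Topology

noncomputable section

/-- Real tensors of order `D` and format `d 0 × ⋯ × d (D-1)`. -/
abbrev Tensor {D : ℕ} (d : Fin D → ℕ) : Type := (∀ m, Fin (d m)) → ℝ

/-- The full contraction `x ∘ B = ∑ⱼ x[j] B[j]` of two tensors of the same format. -/
def contract {D : ℕ} {d : Fin D → ℕ} (x B : Tensor d) : ℝ := ∑ j, x j * B j

/-- A complete binary tree of depth `K` (all leaves at depth `K`).  Each internal node carries a
split rule `x[j] ≤ c` (left child) / `x[j] > c` (right child). -/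
inductive SplitTree {D : ℕ} (d : Fin D → ℕ) : ℕ → Type
  | leaf : SplitTree d 0
  | node {K : ℕ} (j : ∀ m, Fin (d m)) (c : ℝ) (left right : SplitTree d K) : SplitTree d (K + 1)

/-- The leaves of a complete binary tree of depth `K`, as root-to-leaf paths; `false` is a step to
the left child and `true` a step to the right child. -/
abbrev LeafNode (K : ℕ) : Type := Fin K → Bool

/-- The cell of the input space that is attached to the leaf `t`. -/
def SplitTree.region {D : ℕ} {d : Fin D → ℕ} :
    {K : ℕ} → SplitTree d K → LeafNode K → Set (Tensor d)
  | _, .leaf, _ => Set.univ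
  | _, .node j c left right, t =>
      match t 0 with
      | false => {x | x j ≤ c} ∩ left.region (fun k => t k.succ)
      | true => {x | c < x j} ∩ right.region (fun k => t k.succ)

/-- Parameters of a rank-`R` CP model: the weights `λ_r` and, for each mode `m`, the factor
vectors `a m r ∈ ℝ^(d m)`, `r = 1, …, R`. -/
abbrev CPParam {D : ℕ} (d : Fin D → ℕ) (R : ℕ) : Type :=
  (Fin R → ℝ) × (∀ m, Fin R → Fin (d m) → ℝ)

/-- The `r`-th component `λ_r a_r⁽¹⁾ × ⋯ × a_r⁽ᴰ⁾` of a CP decomposition. -/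
def cpTerm {D : ℕ} {d : Fin D → ℕ} {R : ℕ} (θ : CPParam d R) (r : Fin R) : Tensor d :=
  fun j => θ.1 r * ∏ m, θ.2 m r (j m)

/-- The tensor `∑_r λ_r a_r⁽¹⁾ × ⋯ × a_r⁽ᴰ⁾`. -/
def cpTensor {D : ℕ} {d : Fin D → ℕ} {R : ℕ} (θ : CPParam d R) : Tensor d :=
  ∑ r, cpTerm θ r

/-- Parameters of a rank-`(R 0, …, R (D-1))` Tucker model: the core tensor `G` and, for each mode
`m`, the factor matrix `A m` of format `R m × d m`, given by its rows. -/
abbrev TuckerParam {D : ℕ} (d R : Fin D → ℕ) : Type :=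
  Tensor R × (∀ m, Fin (R m) → Fin (d m) → ℝ)

/-- The component `G[ρ] A₁[ρ₁, :] × ⋯ × A_D[ρ_D, :]` of a Tucker decomposition. -/
def tuckerTerm {D : ℕ} {d R : Fin D → ℕ} (θ : TuckerParam d R) (ρ : ∀ m, Fin (R m)) : Tensor d :=
  fun j => θ.1 ρ * ∏ m, θ.2 m (ρ m) (j m)

/-- The tensor `G ×₁ A₁ ×₂ ⋯ ×_D A_D`. -/
def tuckerTensor {D : ℕ} {d R : Fin D → ℕ} (θ : TuckerParam d R) : Tensor d :=
  ∑ ρ, tuckerTerm θ ρ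

/-- The law of one observation `(x, y)` of a leaf regression model with coefficient `B`:
`x ∼ Q` and `y = x ∘ B + e`, with `e ∼ N(0, v)` independent of `x`. -/
def leafLaw {D : ℕ} {d : Fin D → ℕ} (Q : Measure (Tensor d)) (v : ℝ≥0) (B : Tensor d) :
    Measure (Tensor d × ℝ) :=
  (Q.prod (gaussianReal 0 v)).map (fun p => (p.1, contract p.1 B + p.2))

/-- The CP parameter `θ₀` is (globally) identifiable up to permutation in the parameter space `Θ`:
a parameter in `Θ` that gives the same law of the observations has the same components as `θ₀` up
to their order.  (Comparing components rather than factor vectors ignores the trivial rescalings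
inside a component; it makes no difference if `Θ` imposes a normalisation.) -/
def CPIdentifiable {D : ℕ} {d : Fin D → ℕ} {R : ℕ} (Q : Measure (Tensor d)) (v : ℝ≥0)
    (Θ : Set (CPParam d R)) (θ₀ : CPParam d R) : Prop :=
  ∀ θ ∈ Θ, leafLaw Q v (cpTensor θ) = leafLaw Q v (cpTensor θ₀) →
    ∃ σ : Equiv.Perm (Fin R), ∀ r, cpTerm θ (σ r) = cpTerm θ₀ r

/-- The Tucker parameter `θ₀` is (globally) identifiable up to permutation in the parameter space
`Θ`: a parameter in `Θ` that gives the same law of the observations has the same components as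
`θ₀` up to permutations of the component indices of the single modes. -/
def TuckerIdentifiable {D : ℕ} {d R : Fin D → ℕ} (Q : Measure (Tensor d)) (v : ℝ≥0)
    (Θ : Set (TuckerParam d R)) (θ₀ : TuckerParam d R) : Prop :=
  ∀ θ ∈ Θ, leafLaw Q v (tuckerTensor θ) = leafLaw Q v (tuckerTensor θ₀) →
    ∃ σ : ∀ m, Equiv.Perm (Fin (R m)),
      ∀ ρ, tuckerTerm θ (fun m => σ m (ρ m)) = tuckerTerm θ₀ ρ

open Classical in
/-- The indices of those of the first `n` observations whose input lies in the cell `S`. -/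
def leafSample {D : ℕ} {d : Fin D → ℕ} (S : Set (Tensor d)) (x : ℕ → Tensor d) (n : ℕ) :
    Finset ℕ :=
  (Finset.range n).filter (fun i => x i ∈ S)

/-- The Gaussian likelihood of the coefficient `B`, for the observations `(x i, y i)`, `i < n`,
with `x i` in the cell `S`. -/
def leafLikelihood {D : ℕ} {d : Fin D → ℕ} (S : Set (Tensor d)) (v : ℝ≥0)
    (x : ℕ → Tensor d) (y : ℕ → ℝ) (n : ℕ) (B : Tensor d) : ℝ :=
  ∏ i ∈ leafSample S x n, gaussianPDFReal (contract (x i) B) v (y i)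

/-- `θ` is a maximum likelihood estimate, over the parameter space `Θ` of a leaf model whose
coefficient tensor is `coef θ`, from the observations `i < n` in the cell `S`.  (The set of
maximisers is the same for every error variance `v > 0`.) -/
def IsLeafMLE {D : ℕ} {d : Fin D → ℕ} {P : Type} (coef : P → Tensor d) (Θ : Set P)
    (S : Set (Tensor d)) (v : ℝ≥0) (x : ℕ → Tensor d) (y : ℕ → ℝ) (n : ℕ) (θ : P) : Prop :=
  θ ∈ Θ ∧ IsMaxOn (fun θ' => leafLikelihood S v x y n (coef θ')) Θ θ

end

/-! This is Wald's consistency argument. With `Δ = B - B₀`, the log-likelihood ratio of `B₀` to `B`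
is `1/(2v)` times the sum over the leaf of the excess `(x ∘ Δ)² - 2e(x ∘ Δ)`. If `B` and `B₀` give
different laws, `x ∘ Δ` is not almost surely zero. Errors are centred and independent of `x`, so the
excess has positive mean, and `exists_excess_lower_bound` makes this uniform near `Δ`. `Q` needs no
moments, because large `x` are truncated.

A weak law for the observations in the leaf makes the sum of each such bound positive with
probability tending to one. Finitely many neighbourhoods cover the coefficients at distance at least
`ε` from `B₀`, so a maximiser is unlikely to lie there. Identifiability enters only through the
coefficient tensor, which a permutation of components does not change. -/

/-- If the law of `Z` conditional on `Z ∈ S` is `ν` (unless `S` is never hit), then the law of `Z`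
restricted to that event is a multiple of `ν`. -/
theorem map_restrict_eq_smul_of_cond {Ω α : Type*} [MeasurableSpace Ω] [MeasurableSpace α]
    {μ : Measure Ω} [IsFiniteMeasure μ] {Z : Ω → α} {A : Set Ω} {ν : Measure α}
    (h : μ A ≠ 0 → (μ[|A]).map Z = ν) : (μ.restrict A).map Z = μ A • ν := by
  by_cases hA : μ A = 0
  · simp [Measure.restrict_eq_zero.2 hA, hA]
  · rw [← h hA, ProbabilityTheory.cond, Measure.map_smul, smul_smul,
      ENNReal.mul_inv_cancel hA (measure_ne_top μ A), one_smul]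

/-! ### Weak law of large numbers for observations falling into a cell -/

section SelectedSums

variable {Ω α : Type*} [MeasurableSpace Ω] [MeasurableSpace α] {μ : Measure Ω}
  {Z : ℕ → Ω → α} {S : Set α} {ν : Measure α}

theorem integral_indicator_comp (hS : MeasurableSet S) {Z : Ω → α} (hZ : Measurable Z)
    (hlaw : (μ.restrict (Z ⁻¹' S)).map Z = μ (Z ⁻¹' S) • ν)
    {f : α → ℝ} (hf : Measurable f) :
    ∫ ω, S.indicator f (Z ω) ∂μ = μ.real (Z ⁻¹' S) * ∫ z, f z ∂ν := by
  have h1 : (fun ω => S.indicator f (Z ω)) = (Z ⁻¹' S).indicator (f ∘ Z) := by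
    ext ω; rfl
  have h2 := integral_map (μ := μ.restrict (Z ⁻¹' S)) hZ.aemeasurable (f := f)
    hf.aestronglyMeasurable
  rw [h1, integral_indicator (hZ hS)]
  simp only [Function.comp_apply]
  rw [← h2, hlaw, integral_smul_measure, smul_eq_mul, Measure.real]

theorem memLp_indicator_comp [IsProbabilityMeasure μ] (hS : MeasurableSet S)
    {Z : Ω → α} (hZ : Measurable Z)
    (hlaw : (μ.restrict (Z ⁻¹' S)).map Z = μ (Z ⁻¹' S) • ν)
    {f : α → ℝ} {p : ℝ≥0∞} (hf : MemLp f p ν) :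
    MemLp (fun ω => S.indicator f (Z ω)) p μ := by
  have h1 : (fun ω => S.indicator f (Z ω)) = (Z ⁻¹' S).indicator (f ∘ Z) := by
    ext ω; rfl
  rw [h1, memLp_indicator_iff_restrict (hZ hS)]
  refine MemLp.comp_of_map ?_ hZ.aemeasurable
  rw [hlaw]
  exact hf.smul_measure (measure_ne_top μ _)

/-- A weak law of large numbers for the observations of an independent sample that fall into `S`:
if their common law gives `h` a positive mean and a finite second moment, and if the expected
number of such observations is infinite, then the sum of `h` over them is positive with
probability tending to one. -/
theorem tendsto_measure_sum_indicator_nonpos [IsProbabilityMeasure μ]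
    (hZ : ∀ i, Measurable (Z i)) (hindep : iIndepFun Z μ)
    (hS : MeasurableSet S)
    (hlaw : ∀ i, (μ.restrict (Z i ⁻¹' S)).map (Z i) = μ (Z i ⁻¹' S) • ν)
    (hcount : Tendsto (fun n => ∑ i ∈ Finset.range n, μ.real (Z i ⁻¹' S)) atTop atTop)
    {h : α → ℝ} (hm : Measurable h) (h2 : MemLp h 2 ν) (hpos : 0 < ∫ z, h z ∂ν) :
    Tendsto (fun n => μ {ω | ∑ i ∈ Finset.range n, S.indicator h (Z i ω) ≤ 0}) atTop (𝓝 0) := by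
  set a : ℕ → ℝ := fun n => ∑ i ∈ Finset.range n, μ.real (Z i ⁻¹' S)
  set m := ∫ z, h z ∂ν
  set c := ∫ z, (h z) ^ 2 ∂ν
  have hW2 : ∀ i, MemLp (fun ω => S.indicator h (Z i ω)) 2 μ := fun i =>
    memLp_indicator_comp hS (hZ i) (hlaw i) h2
  have hWi : iIndepFun (fun i ω => S.indicator h (Z i ω)) μ :=
    hindep.comp (fun _ => S.indicator h) fun _ => hm.indicator hS
  have hvar : ∀ n, variance (∑ i ∈ Finset.range n, fun ω => S.indicator h (Z i ω)) μ
      ≤ a n * c := by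
    intro n
    rw [IndepFun.variance_sum (fun i _ => hW2 i) fun i _ j _ hij => hWi.indepFun hij,
      Finset.sum_mul]
    refine Finset.sum_le_sum fun i _ => ?_
    refine (variance_le_expectation_sq (hW2 i).1).trans (le_of_eq ?_)
    rw [← integral_indicator_comp hS (hZ i) (hlaw i) (hm.pow_const 2)]
    refine integral_congr_ae (Eventually.of_forall fun ω => ?_)
    by_cases hω : Z i ω ∈ S <;> simp [hω]
  have hmean : ∀ n, ∫ ω, (∑ i ∈ Finset.range n, fun ω => S.indicator h (Z i ω)) ω ∂μ
      = a n * m := by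
    intro n
    simp only [Finset.sum_apply]
    rw [integral_finsetSum _ fun i _ => (hW2 i).integrable one_le_two, Finset.sum_mul]
    exact Finset.sum_congr rfl fun i _ => integral_indicator_comp hS (hZ i) (hlaw i) hm
  -- Chebyshev at distance `a n * m` from the mean, with variance at most `a n * c`, gives this
  -- bound.
  have hlim : Tendsto (fun n => ENNReal.ofReal (c / m ^ 2 * (a n)⁻¹)) atTop (𝓝 0) := by
    have := ENNReal.tendsto_ofReal ((hcount.inv_tendsto_atTop).const_mul (c / m ^ 2))
    simpa using this
  refine tendsto_of_tendsto_of_tendsto_of_le_of_le' tendsto_const_nhds hlim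
    (Eventually.of_forall fun _ => zero_le) ?_
  filter_upwards [hcount.eventually_gt_atTop 0] with n hn
  have ham : 0 < a n * m := mul_pos hn hpos
  have hsum : MemLp (∑ i ∈ Finset.range n, fun ω => S.indicator h (Z i ω)) 2 μ :=
    memLp_finsetSum' _ fun i _ => hW2 i
  refine (measure_mono ?_).trans ((meas_ge_le_variance_div_sq hsum ham).trans
    (ENNReal.ofReal_le_ofReal ?_))
  · intro ω hω
    simp only [Set.mem_ofPred_eq] at hω ⊢
    rw [hmean, abs_sub_comm]
    refine le_trans ?_ (le_abs_self _)
    simp only [Finset.sum_apply]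
    linarith
  · calc _ ≤ a n * c / (a n * m) ^ 2 := by gcongr; exact hvar n
      _ = _ := by have := hn.ne'; field_simp

open Classical in
/-- If almost surely infinitely many observations fall into `S`, then their expected number is
infinite. -/
theorem tendsto_sum_measureReal_of_ae_tendsto_card [IsProbabilityMeasure μ]
    {A : ℕ → Set Ω}
    (hcount : ∀ᵐ ω ∂μ,
      Tendsto (fun n => ((Finset.range n).filter (fun i => ω ∈ A i)).card) atTop atTop) :
    Tendsto (fun n => ∑ i ∈ Finset.range n, μ.real (A i)) atTop atTop := by
  rw [← not_summable_iff_tendsto_nat_atTop_of_nonneg fun _ => measureReal_nonneg]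
  intro hsum
  have hfin : ∑' i, μ (A i) ≠ ∞ := by
    have : ∀ i, μ (A i) = ENNReal.ofReal (μ.real (A i)) := fun i => by simp
    simp_rw [this]
    exact hsum.tsum_ofReal_ne_top
  -- By Borel–Cantelli, summable probabilities would allow only finitely many hits.
  obtain ⟨ω, h1, h2⟩ := (hcount.and (ae_eventually_notMem hfin)).exists
  obtain ⟨N, hN⟩ := eventually_atTop.1 h2
  obtain ⟨n, hn⟩ := (h1.eventually_gt_atTop N).exists
  refine absurd (Finset.card_le_card (t := Finset.range N) fun i hi => ?_)
    (by simpa using hn)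
  rw [Finset.mem_filter] at hi
  rw [Finset.mem_range]
  by_contra hc
  exact hN i (not_lt.1 hc) hi.2

end SelectedSums

/-! ### The contraction as a function of either tensor -/

section Contract

variable {D : ℕ} {d : Fin D → ℕ}

theorem contract_sub (x B C : Tensor d) : contract x (B - C) = contract x B - contract x C := by
  simp [contract, mul_sub]

@[fun_prop]
theorem Measurable.contract {α : Type*} [MeasurableSpace α] {f : α → Tensor d} (hf : Measurable f)
    (B : Tensor d) : Measurable fun a => contract (f a) B := by
  unfold _root_.contract
  fun_prop

theorem continuous_contract (x : Tensor d) : Continuous (contract x) := by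
  unfold contract
  fun_prop

theorem abs_contract_le (x B : Tensor d) :
    |contract x B| ≤ Fintype.card (∀ m, Fin (d m)) * (‖x‖ * ‖B‖) := by
  unfold contract
  refine (Finset.abs_sum_le_sum_abs _ _).trans ?_
  calc _ ≤ ∑ _j : (∀ m, Fin (d m)), ‖x‖ * ‖B‖ := by
        refine Finset.sum_le_sum fun j _ => ?_
        rw [abs_mul]
        exact mul_le_mul (norm_le_pi_norm x j) (norm_le_pi_norm B j) (abs_nonneg _) (norm_nonneg _)
    _ = _ := by simp

end Contract

/-- Gaussian fourth moments are finite. The function serves as a dominating envelope for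
`excessLowerBound`. -/
theorem memLp_sq_const_add_abs_gaussianReal (c : ℝ) (v : ℝ≥0) :
    MemLp (fun e : ℝ => (c + |e|) ^ 2) 2 (gaussianReal 0 v) := by
  have h4 : MemLp (fun e : ℝ => c + |e|) 4 (gaussianReal 0 v) :=
    (memLp_const c).add (memLp_id_gaussianReal' 4 (by simp)).norm
  have : ENNReal.HolderTriple 4 4 2 := ⟨by
    rw [show (4 : ℝ≥0∞) = 2 * 2 by norm_num, ENNReal.mul_inv (by simp) (by simp), ← mul_add,
      ENNReal.inv_two_add_inv_two, mul_one]⟩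
  have := h4.mul (r := 2) h4
  simpa [pow_two, Pi.mul_def] using this

/-! ### Local lower bounds for the excess squared error -/

section LocalBound

variable {D : ℕ} {d : Fin D → ℕ}

/-- A lower bound for the excess squared error `(x ∘ Δ)² - 2 e (x ∘ Δ)` that is uniform over all
`Δ` with `|x ∘ Δ - x ∘ Δ₀| ≤ η` for `‖x‖ ≤ M`. -/
noncomputable def excessLowerBound (Δ₀ : Tensor d) (M η : ℝ) (p : Tensor d × ℝ) : ℝ :=
  if ‖p.1‖ ≤ M then
    contract p.1 Δ₀ ^ 2 - 2 * p.2 * contract p.1 Δ₀ - 2 * η * (|contract p.1 Δ₀| + |p.2|)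
  else -p.2 ^ 2

theorem measurable_excessLowerBound (Δ₀ : Tensor d) (M η : ℝ) :
    Measurable (excessLowerBound Δ₀ M η) := by
  unfold excessLowerBound
  refine Measurable.ite (measurableSet_le (by fun_prop) (by fun_prop)) ?_ (by fun_prop)
  have := (measurable_fst (α := Tensor d) (β := ℝ)).contract Δ₀
  have h2 : Measurable fun p : Tensor d × ℝ => |contract p.1 Δ₀| := this.abs
  have h3 : Measurable fun p : Tensor d × ℝ => |p.2| := measurable_snd.abs
  fun_prop

theorem excessLowerBound_le {Δ₀ Δ : Tensor d} {M η : ℝ} {x : Tensor d}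
    (h : ‖x‖ ≤ M → |contract x Δ - contract x Δ₀| ≤ η) (e : ℝ) :
    excessLowerBound Δ₀ M η (x, e) ≤ contract x Δ ^ 2 - 2 * e * contract x Δ := by
  unfold excessLowerBound
  split_ifs with hx
  · set u := contract x Δ₀
    obtain ⟨w, hw⟩ : ∃ w, contract x Δ = u + w := ⟨_, (add_sub_cancel _ _).symm⟩
    have hη := h hx
    rw [hw, add_sub_cancel_left] at hη
    rw [hw]
    -- Replacing `u` by `u + w` changes the excess by `w² - 2(e - u)w`, and `w²` can be dropped.
    have h1 : (e - u) * w ≤ η * (|u| + |e|) := by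
      calc (e - u) * w ≤ |e - u| * |w| := by rw [← abs_mul]; exact le_abs_self _
        _ ≤ (|u| + |e|) * η := by
          gcongr
          exact (abs_sub _ _).trans (add_comm _ _).le
        _ = _ := mul_comm _ _
    nlinarith [sq_nonneg w]
  -- Completing the square, `u² - 2eu = (u - e)² - e²`, so `-e²` is a bound whatever `Δ` is.
  · nlinarith [sq_nonneg (contract x Δ - e)]

/-- On `‖x‖ ≤ M` the contraction is bounded, and elsewhere only `e` appears. Gaussian moments
therefore suffice. -/
theorem memLp_excessLowerBound (Q : Measure (Tensor d)) [IsProbabilityMeasure Q] (v : ℝ≥0)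
    (Δ₀ : Tensor d) {M η : ℝ} (hM : 0 ≤ M) (hη : 0 ≤ η) :
    MemLp (excessLowerBound Δ₀ M η) 2 (Q.prod (gaussianReal 0 v)) := by
  set a : ℝ := Fintype.card (∀ m, Fin (d m)) * (M * ‖Δ₀‖)
  have ha : 0 ≤ a := by positivity
  refine (((memLp_sq_const_add_abs_gaussianReal (a + η) v).comp_snd Q)).mono'
    (measurable_excessLowerBound Δ₀ M η).aestronglyMeasurable
    (Eventually.of_forall fun p => ?_)
  rw [Real.norm_eq_abs]
  unfold excessLowerBound
  have he := abs_nonneg p.2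
  split_ifs with hx
  · have hu : |contract p.1 Δ₀| ≤ a := (abs_contract_le _ _).trans (by simp only [a]; gcongr)
    set u := contract p.1 Δ₀
    have hu0 := abs_nonneg u
    have h1 : |u ^ 2 - 2 * p.2 * u - 2 * η * (|u| + |p.2|)|
        ≤ |u| ^ 2 + 2 * |p.2| * |u| + 2 * η * (|u| + |p.2|) := by
      refine (abs_sub _ _).trans (add_le_add ((abs_sub _ _).trans (le_of_eq ?_)) (le_of_eq ?_))
      · simp [abs_mul]
      · exact abs_of_nonneg (by positivity)
    calc _ ≤ _ := h1
      _ ≤ a ^ 2 + 2 * |p.2| * a + 2 * η * (a + |p.2|) := by gcongr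
      _ ≤ (a + η + |p.2|) ^ 2 := by nlinarith [sq_nonneg η, sq_nonneg |p.2|]
  · rw [abs_neg, abs_pow]
    gcongr
    linarith

theorem integral_excessLowerBound_section (v : ℝ≥0) (Δ₀ : Tensor d) (M η : ℝ) (x : Tensor d) :
    ∫ e, excessLowerBound Δ₀ M η (x, e) ∂(gaussianReal 0 v) =
      if ‖x‖ ≤ M then contract x Δ₀ ^ 2 - 2 * η * (|contract x Δ₀| + ∫ e, |e| ∂(gaussianReal 0 v))
      else -∫ e, e ^ 2 ∂(gaussianReal 0 v) := by
  have h1 : Integrable (fun e : ℝ => e) (gaussianReal 0 v) :=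
    (memLp_id_gaussianReal' 1 (by simp)).integrable le_rfl
  unfold excessLowerBound
  split_ifs with hx
  · dsimp only
    have h2 : Integrable (fun e : ℝ => |contract x Δ₀| + |e|) (gaussianReal 0 v) :=
      (integrable_const _).add h1.abs
    have h3 : Integrable (fun e : ℝ => 2 * e * contract x Δ₀) (gaussianReal 0 v) :=
      (h1.const_mul 2).mul_const _
    have h4 : Integrable (fun e : ℝ => contract x Δ₀ ^ 2 - 2 * e * contract x Δ₀)
        (gaussianReal 0 v) := (integrable_const _).sub h3
    rw [integral_sub h4 (h2.const_mul _),
      integral_sub (integrable_const _) h3, integral_mul_const, integral_const_mul,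
      integral_id_gaussianReal, integral_const_mul, integral_add (integrable_const _) h1.abs]
    simp
  · rw [integral_neg]

/-- If `x ∘ Δ₀` does not vanish almost surely, then the excess squared error has near `Δ₀` a
square-integrable uniform lower bound of positive mean. -/
theorem exists_excess_lower_bound (Q : Measure (Tensor d)) [IsProbabilityMeasure Q] (v : ℝ≥0)
    {Δ₀ : Tensor d} (hΔ₀ : ¬ ∀ᵐ x ∂Q, contract x Δ₀ = 0) :
    ∃ h : Tensor d × ℝ → ℝ, Measurable h ∧ MemLp h 2 (Q.prod (gaussianReal 0 v)) ∧
      0 < ∫ p, h p ∂(Q.prod (gaussianReal 0 v)) ∧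
      ∃ δ > 0, ∀ Δ, ‖Δ - Δ₀‖ < δ → ∀ x e,
        h (x, e) ≤ contract x Δ ^ 2 - 2 * e * contract x Δ := by
  set κ := ∫ e, |e| ∂(gaussianReal 0 v)
  set κ₂ := ∫ e, e ^ 2 ∂(gaussianReal 0 v)
  have hκ : 0 ≤ κ := integral_nonneg fun _ => abs_nonneg _
  have hκ₂ : 0 ≤ κ₂ := integral_nonneg fun _ => sq_nonneg _
  set η : ℕ → ℝ := fun n => 1 / ((n : ℝ) + 1)
  have hη : ∀ n, 0 < η n := fun n => by positivity
  have hη1 : ∀ n, η n ≤ 1 := fun n => by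
    rw [div_le_one (by positivity)]; linarith [(Nat.cast_nonneg n : (0 : ℝ) ≤ n)]
  -- `F n` bounds from below the mean over `e` of the bound with `M = n` and `η = η n`. The cap at
  -- `1` permits dominated convergence although `x ∘ Δ₀` may fail to be square-integrable.
  set F : ℕ → Tensor d → ℝ := fun n x =>
    if ‖x‖ ≤ n then min (contract x Δ₀ ^ 2 - 2 * η n * (|contract x Δ₀| + κ)) 1 else -κ₂
  have hcm : Measurable fun x : Tensor d => contract x Δ₀ := measurable_id.contract Δ₀
  have hcma : Measurable fun x : Tensor d => |contract x Δ₀| := hcm.abs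
  have hFm : ∀ n, Measurable (F n) := fun n =>
    Measurable.ite (measurableSet_le (by fun_prop) (by fun_prop)) (by fun_prop) (by fun_prop)
  have hFb : ∀ n x, ‖F n x‖ ≤ 1 + 2 * κ + κ₂ := by
    intro n x
    rw [Real.norm_eq_abs, abs_le]
    simp only [F]
    split_ifs with hx
    · refine ⟨le_min ?_ (by linarith), (min_le_right _ _).trans (by linarith)⟩
      -- Since `η n ≤ 1`, `u² - 2 η n |u| ≥ -(η n)² ≥ -1` and `2 η n κ ≤ 2κ`.
      have := mul_le_mul_of_nonneg_right (hη1 n) hκ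
      have h2 := mul_le_mul (hη1 n) (hη1 n) (hη n).le zero_le_one
      nlinarith [sq_nonneg (|contract x Δ₀| - η n), sq_abs (contract x Δ₀)]
    · constructor <;> linarith
  have hlim : Tendsto (fun n => ∫ x, F n x ∂Q) atTop (𝓝 (∫ x, min (contract x Δ₀ ^ 2) 1 ∂Q)) := by
    refine tendsto_integral_of_dominated_convergence (fun _ => 1 + 2 * κ + κ₂)
      (fun n => (hFm n).aestronglyMeasurable) (integrable_const _)
      (fun n => Eventually.of_forall (hFb n)) (Eventually.of_forall fun x => ?_)
    have h1 : Tendsto (fun n => min (contract x Δ₀ ^ 2 - 2 * η n * (|contract x Δ₀| + κ)) 1) atTop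
        (𝓝 (min (contract x Δ₀ ^ 2 - 2 * 0 * (|contract x Δ₀| + κ)) 1)) :=
      ((tendsto_const_nhds.sub
        ((tendsto_one_div_add_atTop_nhds_zero_nat.const_mul 2).mul_const _)).min tendsto_const_nhds)
    simp only [mul_zero, zero_mul, sub_zero] at h1
    refine h1.congr' ?_
    filter_upwards [tendsto_natCast_atTop_atTop.eventually_ge_atTop ‖x‖] with n hn
    simp [F, hn]
  have hpos : 0 < ∫ x, min (contract x Δ₀ ^ 2) 1 ∂Q := by
    have h0 : ∀ x, 0 ≤ min (contract x Δ₀ ^ 2) 1 := fun x => le_min (sq_nonneg _) zero_le_one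
    refine lt_of_le_of_ne (integral_nonneg h0) fun h => hΔ₀ ?_
    have hi : Integrable (fun x => min (contract x Δ₀ ^ 2) 1) Q :=
      (integrable_const (1 : ℝ)).mono' (by fun_prop) (Eventually.of_forall fun x => by
        rw [Real.norm_eq_abs, abs_of_nonneg (h0 x)]; exact min_le_right _ _)
    filter_upwards [(integral_eq_zero_iff_of_nonneg h0 hi).1 h.symm] with x hx
    by_contra hne
    have : 0 < min (contract x Δ₀ ^ 2) 1 := lt_min (by positivity) one_pos
    exact this.ne' hx
  obtain ⟨n, hn⟩ := (hlim.eventually_const_lt hpos).exists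
  have hL := memLp_excessLowerBound Q v Δ₀ (Nat.cast_nonneg n) (hη n).le
  refine ⟨_, measurable_excessLowerBound Δ₀ n (η n), hL, ?_,
    -- This radius keeps `x ∘ Δ` within `η n` of `x ∘ Δ₀` for `‖x‖ ≤ n`; the `+ 1` keeps the
    -- denominator positive.
    η n / (Fintype.card (∀ m, Fin (d m)) * n + 1), by have := hη n; positivity, ?_⟩
  · have hint := hL.integrable one_le_two
    rw [integral_prod _ hint]
    refine hn.trans_le (integral_mono ((integrable_const _).mono' (hFm n).aestronglyMeasurable
      (Eventually.of_forall (hFb n))) hint.integral_prod_left fun x => ?_)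
    simp only [integral_excessLowerBound_section, F]
    split_ifs
    · exact min_le_left _ _
    · exact le_rfl
  · intro Δ hΔ x e
    refine excessLowerBound_le (fun hx => ?_) e
    rw [← contract_sub]
    rw [lt_div_iff₀ (by positivity)] at hΔ
    calc _ ≤ _ := abs_contract_le _ _
      _ ≤ Fintype.card (∀ m, Fin (d m)) * (n * ‖Δ - Δ₀‖) := by gcongr
      _ ≤ _ := by nlinarith [norm_nonneg (Δ - Δ₀)]

end LocalBound

/-! ### Likelihood of the leaf model -/

section LeafModel

variable {D : ℕ} {d : Fin D → ℕ}

theorem SplitTree.measurableSet_region {K : ℕ} (T : SplitTree d K) (t : LeafNode K) :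
    MeasurableSet (T.region t) := by
  induction T with
  | leaf => exact MeasurableSet.univ
  | node j c left right ihl ihr =>
    unfold SplitTree.region
    split
    · exact (measurableSet_le (by fun_prop) (by fun_prop)).inter (ihl _)
    · exact (measurableSet_lt (by fun_prop) (by fun_prop)).inter (ihr _)

/-- Coefficients that give almost surely the same regression function define the same model. -/
theorem leafLaw_congr {Q : Measure (Tensor d)} {v : ℝ≥0} {B C : Tensor d}
    (h : ∀ᵐ x ∂Q, contract x (B - C) = 0) : leafLaw Q v B = leafLaw Q v C := by
  refine Measure.map_congr ?_
  filter_upwards [Measure.quasiMeasurePreserving_fst.ae h] with p hp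
  rw [contract_sub, sub_eq_zero] at hp
  rw [hp]

theorem continuous_leafLikelihood (S : Set (Tensor d)) (v : ℝ≥0) (x : ℕ → Tensor d) (y : ℕ → ℝ)
    (n : ℕ) : Continuous (leafLikelihood S v x y n) := by
  unfold leafLikelihood gaussianPDFReal
  have := fun i => continuous_contract (x i)
  fun_prop

/-- A coefficient with larger residual sum of squares than `B₀` has a smaller likelihood. -/
theorem leafLikelihood_lt {S : Set (Tensor d)} {v : ℝ≥0} (hv : v ≠ 0) {x : ℕ → Tensor d}
    {y e : ℕ → ℝ} {n : ℕ} {B B₀ : Tensor d} (hy : ∀ i, x i ∈ S → y i = contract (x i) B₀ + e i)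
    (h : 0 < ∑ i ∈ leafSample S x n,
      (contract (x i) (B - B₀) ^ 2 - 2 * e i * contract (x i) (B - B₀))) :
    leafLikelihood S v x y n B < leafLikelihood S v x y n B₀ := by
  have hvpos : (0 : ℝ) < v := NNReal.coe_pos.2 (pos_iff_ne_zero.2 hv)
  unfold leafLikelihood gaussianPDFReal
  -- The normalising constants agree, so only the exponents, the residual sums of squares over
  -- `-2v`, are compared.
  rw [Finset.prod_mul_distrib, Finset.prod_mul_distrib, ← Real.exp_sum, ← Real.exp_sum]
  refine mul_lt_mul_of_pos_left (Real.exp_lt_exp.2 ?_) (Finset.prod_pos fun i _ => by positivity)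
  rw [← sub_pos, ← Finset.sum_sub_distrib]
  have := div_pos h (mul_pos two_pos hvpos)
  rw [Finset.sum_div] at this
  refine this.trans_eq (Finset.sum_congr rfl fun i hi => ?_)
  have hi' : x i ∈ S := by
    classical exact (Finset.mem_filter.1 hi).2
  rw [hy i hi', contract_sub]
  field_simp
  ring

theorem exists_isLeafMLE {P : Type} [TopologicalSpace P] {coef : P → Tensor d}
    (hcoef : Continuous coef) {Θ : Set P} (hΘ : IsCompact Θ) (hne : Θ.Nonempty)
    (S : Set (Tensor d)) (v : ℝ≥0) (x : ℕ → Tensor d) (y : ℕ → ℝ) (n : ℕ) :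
    ∃ θ, IsLeafMLE coef Θ S v x y n θ :=
  hΘ.exists_isMaxOn hne ((continuous_leafLikelihood S v x y n).comp hcoef).continuousOn

/-! ### Wald's compactness argument -/

section Consistency

variable {Ω : Type*} [MeasurableSpace Ω] {μ : Measure Ω} [IsProbabilityMeasure μ]
  {X : ℕ → Ω → Tensor d} {E Y : ℕ → Ω → ℝ} {S : Set (Tensor d)} {Q : Measure (Tensor d)}
  [IsProbabilityMeasure Q] {v : ℝ≥0}

/-- A compact set of coefficients that all differ in law from `B₀` eventually contains, with
probability tending to one, no coefficient of at least the likelihood of `B₀`. -/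
theorem tendsto_measure_exists_leafLikelihood_le (hX : ∀ i, Measurable (X i))
    (hE : ∀ i, Measurable (E i)) (hindep : iIndepFun (fun i ω => (X i ω, E i ω)) μ)
    (hS : MeasurableSet S) (hv : v ≠ 0)
    (hlaw : ∀ i, μ (X i ⁻¹' S) ≠ 0 →
      (μ[|X i ⁻¹' S]).map (fun ω => (X i ω, E i ω)) = Q.prod (gaussianReal 0 v))
    (hcount : ∀ᵐ ω ∂μ, Tendsto (fun n => (leafSample S (fun i => X i ω) n).card) atTop atTop)
    {B₀ : Tensor d} (hY : ∀ i ω, X i ω ∈ S → Y i ω = contract (X i ω) B₀ + E i ω)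
    {C : Set (Tensor d)} (hC : IsCompact C) (hne : ∀ B ∈ C, leafLaw Q v B ≠ leafLaw Q v B₀) :
    Tendsto (fun n => μ {ω | ∃ B ∈ C, leafLikelihood S v (fun i => X i ω) (fun i => Y i ω) n B₀ ≤
      leafLikelihood S v (fun i => X i ω) (fun i => Y i ω) n B}) atTop (𝓝 0) := by
  have hloc : ∀ B ∈ C, ∃ h : Tensor d × ℝ → ℝ, Measurable h ∧
      MemLp h 2 (Q.prod (gaussianReal 0 v)) ∧ 0 < ∫ p, h p ∂(Q.prod (gaussianReal 0 v)) ∧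
      ∃ δ > 0, ∀ Δ, ‖Δ - (B - B₀)‖ < δ → ∀ x e,
        h (x, e) ≤ contract x Δ ^ 2 - 2 * e * contract x Δ := fun B hB =>
    exists_excess_lower_bound Q v fun h => hne B hB (leafLaw_congr h)
  choose! h hm h2 hpos δ hδ hbound using hloc
  obtain ⟨s, hsC, hcover⟩ := hC.elim_nhds_subcover (fun B => Metric.ball B (δ B))
    fun B hB => Metric.ball_mem_nhds B (hδ B hB)
  have hcount' : Tendsto (fun n => ∑ i ∈ Finset.range n, μ.real (X i ⁻¹' S)) atTop atTop :=
    tendsto_sum_measureReal_of_ae_tendsto_card hcount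
  have hlim : Tendsto (fun n => ∑ B ∈ s, μ {ω | ∑ i ∈ Finset.range n,
      (Prod.fst ⁻¹' S).indicator (h B) (X i ω, E i ω) ≤ 0}) atTop (𝓝 0) := by
    rw [show (0 : ℝ≥0∞) = ∑ _B ∈ s, 0 by simp]
    refine tendsto_finsetSum s fun B hB => ?_
    exact tendsto_measure_sum_indicator_nonpos (Z := fun i ω => (X i ω, E i ω))
      (S := Prod.fst ⁻¹' S) (fun i => (hX i).prodMk (hE i)) hindep (measurable_fst hS)
      (fun i => map_restrict_eq_smul_of_cond (hlaw i)) hcount' (hm B (hsC B hB))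
      (h2 B (hsC B hB)) (hpos B (hsC B hB))
  refine tendsto_of_tendsto_of_tendsto_of_le_of_le tendsto_const_nhds hlim
    (fun _ => zero_le) fun n => ?_
  refine (measure_mono ?_).trans (measure_biUnion_finset_le s _)
  rintro ω ⟨B', hB', hle⟩
  obtain ⟨B, hB, hball⟩ := Set.mem_iUnion₂.1 (hcover hB')
  refine Set.mem_iUnion₂.2 ⟨B, hB, ?_⟩
  simp only [Set.mem_ofPred_eq]
  by_contra hgt
  -- The bound attached to the centre `B` has positive sum and lies below the excess of `B'`, so
  -- `B'` has smaller likelihood than `B₀`.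
  refine hle.not_gt (leafLikelihood_lt (e := fun i => E i ω) hv (fun i => hY i ω) ?_)
  refine (not_le.1 hgt).trans_le ?_
  unfold leafSample
  rw [Finset.sum_filter]
  refine Finset.sum_le_sum fun i _ => ?_
  by_cases hi : X i ω ∈ S
  · rw [Set.indicator_of_mem (by exact hi), if_pos hi]
    refine hbound B (hsC B hB) _ ?_ _ _
    rwa [sub_sub_sub_cancel_right, ← dist_eq_norm]
  · rw [Set.indicator_of_notMem (by exact hi), if_neg hi]

/-- Maximum likelihood estimates over a compact parameter space are consistent for an identifiable
coefficient. -/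
theorem tendstoInMeasure_of_isLeafMLE (hX : ∀ i, Measurable (X i))
    (hE : ∀ i, Measurable (E i)) (hindep : iIndepFun (fun i ω => (X i ω, E i ω)) μ)
    (hS : MeasurableSet S) (hv : v ≠ 0)
    (hlaw : ∀ i, μ (X i ⁻¹' S) ≠ 0 →
      (μ[|X i ⁻¹' S]).map (fun ω => (X i ω, E i ω)) = Q.prod (gaussianReal 0 v))
    (hcount : ∀ᵐ ω ∂μ, Tendsto (fun n => (leafSample S (fun i => X i ω) n).card) atTop atTop)
    {P : Type} [TopologicalSpace P] {coef : P → Tensor d} (hcoef : Continuous coef) {Θ : Set P}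
    {θ₀ : P} (hΘ : IsCompact Θ) (hθ₀ : θ₀ ∈ Θ)
    (hY : ∀ i ω, X i ω ∈ S → Y i ω = contract (X i ω) (coef θ₀) + E i ω)
    (hid : ∀ θ ∈ Θ, leafLaw Q v (coef θ) = leafLaw Q v (coef θ₀) → coef θ = coef θ₀)
    {θhat : ℕ → Ω → P}
    (hhat : ∀ n, ∀ᵐ ω ∂μ,
      IsLeafMLE coef Θ S v (fun i => X i ω) (fun i => Y i ω) n (θhat n ω)) :
    TendstoInMeasure μ (fun n ω => coef (θhat n ω)) atTop (fun _ => coef θ₀) := by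
  rw [tendstoInMeasure_iff_norm]
  intro ε hε
  have hC : IsCompact (coef '' Θ ∩ {B | ε ≤ ‖B - coef θ₀‖}) :=
    (hΘ.image hcoef).inter_right (isClosed_le (by fun_prop) (by fun_prop))
  -- Only monotonicity of the outer measure is used, so `θhat` need not be measurable.
  refine tendsto_of_tendsto_of_tendsto_of_le_of_le tendsto_const_nhds
    (tendsto_measure_exists_leafLikelihood_le hX hE hindep hS hv hlaw hcount hY hC ?_)
    (fun _ => zero_le) fun n => measure_mono_ae ?_
  · rintro _ ⟨⟨θ, hθ, rfl⟩, hfar⟩ heq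
    simp only [Set.mem_ofPred_eq, hid θ hθ heq, sub_self, norm_zero] at hfar
    exact hfar.not_gt hε
  · filter_upwards [hhat n] with ω hω hfar
    exact ⟨_, ⟨⟨_, hω.1, rfl⟩, hfar⟩, hω.2 hθ₀⟩

end Consistency

end LeafModel

/-! ### CP and Tucker parametrisations -/

section Decompositions

variable {D : ℕ} {d : Fin D → ℕ}

theorem continuous_cpTensor {R : ℕ} : Continuous (cpTensor : CPParam d R → Tensor d) := by
  unfold cpTensor cpTerm
  fun_prop

theorem continuous_tuckerTensor {R : Fin D → ℕ} :
    Continuous (tuckerTensor : TuckerParam d R → Tensor d) := by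
  unfold tuckerTensor tuckerTerm
  fun_prop

theorem CPIdentifiable.cpTensor_eq {R : ℕ} {Q : Measure (Tensor d)} {v : ℝ≥0}
    {Θ : Set (CPParam d R)} {θ₀ : CPParam d R} (h : CPIdentifiable Q v Θ θ₀) :
    ∀ θ ∈ Θ, leafLaw Q v (cpTensor θ) = leafLaw Q v (cpTensor θ₀) → cpTensor θ = cpTensor θ₀ := by
  intro θ hθ heq
  obtain ⟨σ, hσ⟩ := h θ hθ heq
  unfold cpTensor
  rw [← Equiv.sum_comp σ]
  exact Finset.sum_congr rfl fun r _ => hσ r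

theorem TuckerIdentifiable.tuckerTensor_eq {R : Fin D → ℕ} {Q : Measure (Tensor d)} {v : ℝ≥0}
    {Θ : Set (TuckerParam d R)} {θ₀ : TuckerParam d R} (h : TuckerIdentifiable Q v Θ θ₀) :
    ∀ θ ∈ Θ, leafLaw Q v (tuckerTensor θ) = leafLaw Q v (tuckerTensor θ₀) →
      tuckerTensor θ = tuckerTensor θ₀ := by
  intro θ hθ heq
  obtain ⟨σ, hσ⟩ := h θ hθ heq
  unfold tuckerTensor
  -- The permutations of the single modes together permute the multi-indices `ρ`.
  rw [← Equiv.sum_comp (Equiv.piCongrRight σ)]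
  exact Finset.sum_congr rfl fun ρ _ => hσ ρ

end Decompositions

theorem mainTheorem3 {D : ℕ} {d : Fin D → ℕ} {K : ℕ} (T : SplitTree d K)
    {Ω : Type*} [MeasurableSpace Ω] (μ : Measure Ω) [IsProbabilityMeasure μ]
    (X : ℕ → Ω → Tensor d) (E Y : ℕ → Ω → ℝ)
    (hX : ∀ i, Measurable (X i)) (hE : ∀ i, Measurable (E i))
    -- the observations are independent
    (hindep : iIndepFun (fun i ω => (X i ω, E i ω)) μ)
    -- an arbitrary leaf; its observations are identically distributed, with independent normal
    -- errors, and their number tends to infinity with the overall sample size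
    (t : LeafNode K) (Q : Measure (Tensor d)) [IsProbabilityMeasure Q] (v : ℝ≥0) (hv : v ≠ 0)
    (hlaw : ∀ i, μ (X i ⁻¹' T.region t) ≠ 0 →
      (μ[|X i ⁻¹' T.region t]).map (fun ω => (X i ω, E i ω)) = Q.prod (gaussianReal 0 v))
    (hcount : ∀ᵐ ω ∂μ,
      Tendsto (fun n => (leafSample (T.region t) (fun i => X i ω) n).card) atTop atTop) :
    -- (a) CP model at the leaf
    (∀ (R : ℕ) (Θ : Set (CPParam d R)) (θ₀ : CPParam d R), IsCompact Θ → θ₀ ∈ Θ →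
      (∀ i ω, X i ω ∈ T.region t → Y i ω = contract (X i ω) (cpTensor θ₀) + E i ω) →
      CPIdentifiable Q v Θ θ₀ →
      (∀ n ω, ∃ θ, IsLeafMLE cpTensor Θ (T.region t) v (fun i => X i ω) (fun i => Y i ω) n θ) ∧
      ∀ θhat : ℕ → Ω → CPParam d R,
        (∀ n, ∀ᵐ ω ∂μ, IsLeafMLE cpTensor Θ (T.region t) v (fun i => X i ω) (fun i => Y i ω) n
          (θhat n ω)) →
        TendstoInMeasure μ (fun n ω => cpTensor (θhat n ω)) atTop (fun _ => cpTensor θ₀)) ∧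
    -- (b) Tucker model at the leaf
    (∀ (R : Fin D → ℕ) (Θ : Set (TuckerParam d R)) (θ₀ : TuckerParam d R), IsCompact Θ → θ₀ ∈ Θ →
      (∀ i ω, X i ω ∈ T.region t → Y i ω = contract (X i ω) (tuckerTensor θ₀) + E i ω) →
      TuckerIdentifiable Q v Θ θ₀ →
      (∀ n ω, ∃ θ, IsLeafMLE tuckerTensor Θ (T.region t) v (fun i => X i ω) (fun i => Y i ω) n
        θ) ∧
      ∀ θhat : ℕ → Ω → TuckerParam d R,
        (∀ n, ∀ᵐ ω ∂μ, IsLeafMLE tuckerTensor Θ (T.region t) v (fun i => X i ω)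
          (fun i => Y i ω) n (θhat n ω)) →
        TendstoInMeasure μ (fun n ω => tuckerTensor (θhat n ω)) atTop
          (fun _ => tuckerTensor θ₀)) :=
  ⟨fun _ _ θ₀ hΘ hθ₀ hY hid =>
    ⟨fun n _ => exists_isLeafMLE continuous_cpTensor hΘ ⟨θ₀, hθ₀⟩ _ v _ _ n,
      fun _ hhat => tendstoInMeasure_of_isLeafMLE hX hE hindep (T.measurableSet_region t) hv hlaw
        hcount continuous_cpTensor hΘ hθ₀ hY hid.cpTensor_eq hhat⟩,
    fun _ _ θ₀ hΘ hθ₀ hY hid =>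
    ⟨fun n _ => exists_isLeafMLE continuous_tuckerTensor hΘ ⟨θ₀, hθ₀⟩ _ v _ _ n,
      fun _ hhat => tendstoInMeasure_of_isLeafMLE hX hE hindep (T.measurableSet_region t) hv hlaw
        hcount continuous_tuckerTensor hΘ hθ₀ hY hid.tuckerTensor_eq hhat⟩⟩
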